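/- **Setting.** A Markov decision model consists of Borel spaces $\mathcal S$ (states) and $\mathcal U$ (actions), i.e. Borel subsets of complete separable metric spaces, nonempty measurable sets $\mathcal U(s)\subseteq\mathcal U$ of feasible actions such that $\mathbb K=\{(s,u): s\in\mathcal S,\ u\in\mathcal U(s)\}$ is measurable, a stochastic kernel $Q$ on $\mathcal S$ given $\mathbb K$, and a measurable reward $r:\mathbb K\to\mathbb R$. Let $\alpha\in[0,1)$. For a randomized history-dependent policy $\pi$ (choosing feasible actions) let $V(\pi,s)=\mathbb E_s^\pi\big[\sum_{t\ge0}\alpha^t r(s_t,u_t)\big]$, and let $V^*(s)=\sup_\pi V(\pi,s)$. The discounted optimality equations are $$V^*(s)=\sup_{u\in\mathcal U(s)}\Big\{r(s,u)+\alpha\int_{\mathcal S}V^*(s')\,Q(ds'|s,u)\Big\},\qquad s\in\mathcal S.\tag{DCOE}$$ Let $A^*(s)\subseteq\mathcal U(s)$ be the set of maximizers in (DCOE) at $s$. An optimal selector is a measurable $f^*:\mathcal S\to\mathcal U$ with $f^*(s)\in A^*(s)$ for all $s$. Let $\Phi$ be the set of stochastic kernels $\varphi$ on $\mathcal U$ given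 $\mathcal S$ with $\varphi(\mathcal U(s)|s)=1$ for all $s$. For a probability measure $\nu$ on $\mathcal S$ and $\varphi\in\Phi$ put $$\overline r(\nu,\varphi)=\int_{\mathcal S}\int_{\mathcal U}r(s,u)\,\varphi(du|s)\,d\nu(s),\qquad F(\nu,\varphi)(\cdot)=\int_{\mathcal S}\int_{\mathcal U}Q(\cdot|s,u)\,\varphi(du|s)\,d\nu(s),$$ and $\overline V^*(\nu)=\sup\big\{\sum_{t\ge0}\alpha^t\,\overline r(\nu_t,\varphi_t):\ \varphi_t\in\Phi,\ \nu_0=\nu,\ \nu_{t+1}=F(\nu_t,\varphi_t)\big\}$. The measurized discounted optimality equations are $$\overline V^*(\nu)=\sup_{\varphi\in\Phi}\big\{\overline r(\nu,\varphi)+\alpha\,\overline V^*(F(\nu,\varphi))\big\}\qquad\text{for all probability measures }\nu\text{ on }\mathcal S.\tag{$\mathcal M$-DCOE}$$ A rule $\varphi\in\Phi$ is called optimal at $\nu$ if it attains this supremum at $\nu$. **Assumptions.** (i) $r$ is upper semicontinuous, bounded above and bounded below on $\mathbb K$, and $\{u\in\mathcal U(s): r(s,u)\ge c\}$ is compact for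 all $s\in\mathcal S$, $c\in\mathbb R$. (ii) $Q$ is strongly continuous: $(s,u)\mapsto\int g(s')\,Q(ds'|s,u)$ is continuous on $\mathbb K$ for every bounded measurable $g$. (iii) There is a policy with finite value from every initial state. (iv) $\{(s,u)\in\mathbb K: s\in\mathcal C\}$ is compact for every compact $\mathcal C\subseteq\mathcal S$. **Theorem.** Under these assumptions (DCOE) and ($\mathcal M$-DCOE) hold, an optimal selector $f^*$ exists, and: 1. For every optimal selector $f^*$, the Dirac kernel $\varphi^*\in\Phi$ with $\varphi^*(\{f^*(s)\}|s)=1$ for all $s\in\mathcal S$, which does not depend on $\nu$, is optimal at every $\nu$. 2. Conversely, $\varphi\in\Phi$ is optimal at a given $\nu$ if and only if $\varphi(A^*(s)|s)=1$ for $\nu$-almost every $s$, and it is optimal at every $\nu$ if and only if $\varphi(A^*(s)|s)=1$ for all $s\in\mathcal S$. In particular, if the optimal selector $f^*$ is unique, then every $\varphi\in\Phi$ that is optimal at every $\nu$ satisfies $\varphi(\{f^*(s)\}|s)=1$ for all $s\in\mathcal S$. -/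

import Mathlib

open MeasureTheory ProbabilityTheory Set

/-- A Markov decision model with state space `S` and action space `U`: nonempty sets of feasible
actions with measurable graph `K`, a stochastic kernel `Q` on `S` given `K`, and a measurable
reward function on `K`. -/
structure MDP (S U : Type*) [MeasurableSpace S] [MeasurableSpace U] where
  /-- the set of feasible actions in each state -/
  feasible : S → Set U
  feasible_nonempty : ∀ s, (feasible s).Nonempty
  measurableSet_graph : MeasurableSet {p : S × U | p.2 ∈ feasible p.1}
  /-- the transition law, given feasible state-action pairs only -/
  Q : Kernel ↥{p : S × U | p.2 ∈ feasible p.1} S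
  markov_Q : IsMarkovKernel Q
  /-- the reward per stage, on feasible state-action pairs only -/
  r : ↥{p : S × U | p.2 ∈ feasible p.1} → ℝ
  measurable_r : Measurable r

namespace MDP

variable {S U : Type*} [MeasurableSpace S] [MeasurableSpace U] (M : MDP S U)

/-- The space of feasible state-action pairs. -/
abbrev K : Type _ := ↥{p : S × U | p.2 ∈ M.feasible p.1}

instance : IsMarkovKernel M.Q := M.markov_Q

/-- The feasible pair made of the state `s` and the feasible action `u`. -/
def pair (s : S) (u : M.feasible s) : M.K := ⟨(s, u.1), u.2⟩

/-- If an action is drawn from `κ (· | x)` while the current state is `σ x`, then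
`pairKernel σ κ (· | x)` is the law of the state-action pair: the product of the Dirac measure at
`σ x` and `κ (· | x)`, seen as a measure on the feasible pairs. -/
noncomputable def pairKernel {X : Type*} [MeasurableSpace X] (σ : X → S) (hσ : Measurable σ)
    (κ : Kernel X U) : Kernel X M.K :=
  (Kernel.deterministic σ hσ ×ₖ κ).comapRight
    (MeasurableEmbedding.subtype_coe M.measurableSet_graph)

lemma isMarkovKernel_pairKernel {X : Type*} [MeasurableSpace X] (σ : X → S) (hσ : Measurable σ)
    (κ : Kernel X U) [IsMarkovKernel κ] (hκ : ∀ x, κ x (M.feasible (σ x)) = 1) :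
    IsMarkovKernel (M.pairKernel σ hσ κ) := by
  refine Kernel.IsMarkovKernel.comapRight _ _ fun x => ?_
  rw [Subtype.range_coe, Kernel.prod_apply, Kernel.deterministic_apply,
    Measure.dirac_prod, Measure.map_apply measurable_prodMk_left M.measurableSet_graph]
  exact hκ x

/-! ### Policies and the value function of the original problem -/

/-- A randomized, history dependent policy: for every `t` a stochastic kernel on the actions given
the admissible history `(s₀, u₀, …, s_{t-1}, u_{t-1}, s_t)`, concentrated on the actions that are
feasible in the current state `s_t`. -/
structure Policy where
  toKernel : (t : ℕ) → Kernel ((Fin t → M.K) × S) U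
  markov : ∀ t, IsMarkovKernel (toKernel t)
  feasible : ∀ t h, toKernel t h (M.feasible h.2) = 1

variable {M}

/-- The law of `(s_t, u_t)` given the past pairs and the current state `s_t`. -/
noncomputable def Policy.pairLaw (π : M.Policy) (t : ℕ) : Kernel ((Fin t → M.K) × S) M.K :=
  M.pairKernel Prod.snd measurable_snd (π.toKernel t)

instance (π : M.Policy) (t : ℕ) : IsMarkovKernel (π.pairLaw t) :=
  haveI := π.markov t
  M.isMarkovKernel_pairKernel _ _ _ (π.feasible t)

/-- The law of `s_{t+1}`, together with the past pairs, given the pairs up to time `t`. -/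
noncomputable def historyStep (M : MDP S U) (t : ℕ) :
    Kernel ((i : Finset.Iic t) → M.K) ((Fin (t + 1) → M.K) × S) :=
  Kernel.deterministic
      (fun (h : (i : Finset.Iic t) → M.K) (i : Fin (t + 1)) =>
        h ⟨i, Finset.mem_Iic.2 (Nat.lt_succ_iff.1 i.2)⟩)
      (measurable_pi_lambda _ fun _ => measurable_pi_apply _) ×ₖ
    M.Q.comap (fun h => h ⟨t, Finset.mem_Iic.2 le_rfl⟩) (measurable_pi_apply _)

instance (t : ℕ) : IsMarkovKernel (M.historyStep t) := by
  unfold historyStep; infer_instance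

/-- The law of `(s_{t+1}, u_{t+1})` given the pairs up to time `t`: first `s_{t+1}` is drawn from
`Q (· | s_t, u_t)`, then `u_{t+1}` from the policy. -/
noncomputable def Policy.step (π : M.Policy) (t : ℕ) :
    Kernel ((i : Finset.Iic t) → M.K) M.K :=
  π.pairLaw (t + 1) ∘ₖ M.historyStep t

instance (π : M.Policy) (t : ℕ) : IsMarkovKernel (π.step t) := by
  unfold Policy.step; infer_instance

/-- The law of `(s₀, u₀)` when `s₀` has law `ν`. -/
noncomputable def Policy.initialLaw (π : M.Policy) (ν : Measure S) : Measure M.K :=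
  (ν.map fun s => ((fun i => i.elim0 : Fin 0 → M.K), s)).bind (π.pairLaw 0)

/-- The Ionescu-Tulcea law of the whole process `(s_t, u_t)_{t ≥ 0}` with initial law `ν` under the
policy `π`, on the space of infinite admissible histories. -/
noncomputable def Policy.law (π : M.Policy) (ν : Measure S) : Measure (ℕ → M.K) :=
  Kernel.trajMeasure (X := fun _ => M.K) (π.initialLaw ν) π.step

/-- The discounted total reward along an admissible history. -/
noncomputable def totalReward (M : MDP S U) (α : ℝ) (ω : ℕ → M.K) : ℝ :=
  ∑' t, α ^ t * M.r (ω t)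

/-- The value `V(π, s)` of the policy `π` from the initial state `s`. -/
noncomputable def Policy.value (π : M.Policy) (α : ℝ) (s : S) : ℝ :=
  ∫ ω, M.totalReward α ω ∂(π.law (Measure.dirac s))

/-- The optimal value function `V*`. -/
noncomputable def optValue (M : MDP S U) (α : ℝ) (s : S) : ℝ :=
  ⨆ π : M.Policy, π.value α s

/-! ### Optimality equations of the original problem -/

/-- The expression `r(s,u) + α 𝔼_Q[V(s') | s,u]`. -/
noncomputable def qValue (M : MDP S U) (α : ℝ) (V : S → ℝ) (k : M.K) : ℝ :=
  M.r k + α * ∫ s', V s' ∂(M.Q k)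

/-- `V` solves the discounted optimality equations
`V(s) = sup_{u ∈ U(s)} (r(s,u) + α 𝔼_Q[V(s') | s,u])` for all `s`. -/
def SolvesDCOE (M : MDP S U) (α : ℝ) (V : S → ℝ) : Prop :=
  ∀ s, IsLUB (range fun u : M.feasible s => M.qValue α V (M.pair s u)) (V s)

/-- The feasible actions that attain the maximum in the optimality equation at `s`. -/
def maximizers (M : MDP S U) (α : ℝ) (V : S → ℝ) (s : S) : Set U :=
  {u | ∃ hu : u ∈ M.feasible s, ∀ u' : M.feasible s,
    M.qValue α V (M.pair s u') ≤ M.qValue α V (M.pair s ⟨u, hu⟩)}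

/-- `f` is a (measurable) selector, i.e. `f(s)` is feasible in every state `s`. -/
def IsSelector (M : MDP S U) (f : S → U) : Prop :=
  Measurable f ∧ ∀ s, f s ∈ M.feasible s

/-- `f` is an optimal selector: a selector attaining, in every state, the maximum in the optimality
equations for the optimal value function. -/
def IsOptimalSelector (M : MDP S U) (α : ℝ) (f : S → U) : Prop :=
  M.IsSelector f ∧ ∀ s, f s ∈ M.maximizers α (M.optValue α) s

/-! ### The measurized counterpart -/

/-- The set `Φ` of Markov decision rules: stochastic kernels `φ` on `U` given `S` with
`φ(U(s) | s) = 1` for all `s`. -/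
structure DecisionRule (M : MDP S U) where
  toKernel : Kernel S U
  markov : IsMarkovKernel toKernel
  feasible : ∀ s, toKernel s (M.feasible s) = 1

/-- The law of the state-action pair given the state, under a decision rule. -/
noncomputable def DecisionRule.pairLaw (φ : M.DecisionRule) : Kernel S M.K :=
  M.pairKernel id measurable_id φ.toKernel

instance (φ : M.DecisionRule) : IsMarkovKernel φ.pairLaw :=
  haveI := φ.markov
  M.isMarkovKernel_pairKernel _ _ _ φ.feasible

/-- The measurized reward `∫_S ∫_U r(s,u) φ(du|s) dν(s)`. -/
noncomputable def liftedReward (M : MDP S U) (ν : ProbabilityMeasure S) (φ : M.DecisionRule) : ℝ :=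
  ∫ s, ∫ k, M.r k ∂(φ.pairLaw s) ∂(ν : Measure S)

/-- The deterministic transition `F(ν,φ)(·) = ∫_S ∫_U Q(·|s,u) φ(du|s) dν(s)`. -/
noncomputable def liftedStep (M : MDP S U) (ν : ProbabilityMeasure S) (φ : M.DecisionRule) :
    ProbabilityMeasure S :=
  ⟨(ν : Measure S).bind (M.Q ∘ₖ φ.pairLaw), inferInstance⟩

/-- The path of state distributions `ν₀ = ν`, `ν_{t+1} = F(ν_t, φ_t)`. -/
noncomputable def liftedPath (M : MDP S U) (ν : ProbabilityMeasure S) (φ : ℕ → M.DecisionRule) :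
    ℕ → ProbabilityMeasure S
  | 0 => ν
  | t + 1 => M.liftedStep (M.liftedPath ν φ t) (φ t)

/-- The optimal measurized value function: the supremum over all sequences of decision rules of
`∑_t α^t r̄(ν_t, φ_t)` along the path started at `ν`. -/
noncomputable def liftedOptValue (M : MDP S U) (α : ℝ) (ν : ProbabilityMeasure S) : ℝ :=
  ⨆ φ : ℕ → M.DecisionRule, ∑' t, α ^ t * M.liftedReward (M.liftedPath ν φ t) (φ t)

/-- The expression `r̄(ν,φ) + α W(F(ν,φ))`. -/
noncomputable def liftedQValue (M : MDP S U) (α : ℝ) (W : ProbabilityMeasure S → ℝ)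
    (ν : ProbabilityMeasure S) (φ : M.DecisionRule) : ℝ :=
  M.liftedReward ν φ + α * W (M.liftedStep ν φ)

/-- `W` solves the measurized discounted optimality equations
`W(ν) = sup_{φ ∈ Φ} (r̄(ν,φ) + α W(F(ν,φ)))` for all `ν`. -/
def SolvesLiftedDCOE (M : MDP S U) (α : ℝ) (W : ProbabilityMeasure S → ℝ) : Prop :=
  ∀ ν, IsLUB (range (M.liftedQValue α W ν)) (W ν)

/-- The decision rule `φ` attains the maximum in the measurized optimality equation at `ν`, for the
optimal measurized value function. -/
def IsOptimalRuleAt (M : MDP S U) (α : ℝ) (ν : ProbabilityMeasure S) (φ : M.DecisionRule) : Prop :=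
  ∀ φ' : M.DecisionRule,
    M.liftedQValue α (M.liftedOptValue α) ν φ' ≤ M.liftedQValue α (M.liftedOptValue α) ν φ

/-! ### Standing assumptions -/

/-- For every state `s` and every real `c`, the set `{u ∈ U(s) : r(s,u) ≥ c}` is compact. -/
def SupCompact [TopologicalSpace U] (M : MDP S U) : Prop :=
  ∀ (s : S) (c : ℝ), IsCompact {u : U | ∃ hu : u ∈ M.feasible s, c ≤ M.r (M.pair s ⟨u, hu⟩)}

/-- `Q` is strongly continuous: `(s,u) ↦ ∫ g(s') Q(ds'|s,u)` is continuous (and then bounded) on the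
feasible pairs for every bounded measurable `g`. -/
def StronglyContinuous [TopologicalSpace S] [TopologicalSpace U] (M : MDP S U) : Prop :=
  ∀ g : S → ℝ, Measurable g → (∃ C, ∀ s, |g s| ≤ C) → Continuous fun k : M.K => ∫ s', g s' ∂(M.Q k)

end MDP

/-!
The Bellman operator is a contraction of the bounded measurable functions for the uniform distance:
strong continuity of `Q` turns every such `V` into an upper semicontinuous `r + α ∫ V dQ`, whose
maximum over the compact fibers of the projection of `K` onto the states is measurable in the
state. Let `V` be the fixed point. A measurable selection of the maximizers is obtained by
maximizing a separating sequence of functions of the action lexicographically.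

Call `V(s) - (r(s,u) + α ∫ V dQ(· | s,u)) ≥ 0` the discrepancy of `(s,u)`; it vanishes exactly if
`u` is a maximizer at `s`. If `μ_t` are laws of state-action pairs such that the state under
`μ_{t+1}` has law `μ_t Q`, telescoping gives
`∑ α^t ∫ r dμ_t = ∫ V dν - ∑ α^t ∫ discrepancy dμ_t`, where `ν` is the law of the first state.
Both the marginals of a policy and the joint laws along a path of the measurized problem have this
property, so the two optimal values are `V` and `ν ↦ ∫ V dν`, and a decision rule is optimal at `ν`
if and only if its discrepancy vanishes almost everywhere.
-/

section Selection

variable {S X : Type*}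

/-- The maximizers of `g` over `A`. -/
def argmaxOn (g : X → ℝ) (A : Set X) : Set X := {x ∈ A | IsMaxOn g A x}

/-- The set obtained from `A` by maximizing `g 0`, …, `g (n - 1)` one after the other, each over the
maximizers of the preceding ones. -/
def lexArgmax (g : ℕ → X → ℝ) (A : Set X) : ℕ → Set X
  | 0 => A
  | n + 1 => argmaxOn (g n) (lexArgmax g A n)

lemma subsingleton_iInter_lexArgmax {g : ℕ → X → ℝ} (hsep : ∀ x y, (∀ n, g n x = g n y) → x = y)
    (A : Set X) : (⋂ n, lexArgmax g A n).Subsingleton := by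
  intro x hx y hy
  rw [mem_iInter] at hx hy
  exact hsep x y fun n => le_antisymm ((hy (n + 1)).2 (hx n)) ((hx (n + 1)).2 (hy n))

variable [TopologicalSpace X]

lemma isGreatest_sSup_image {g : X → ℝ} (hg : UpperSemicontinuous g) {A : Set X}
    (hA : IsCompact A) (hne : A.Nonempty) : IsGreatest (g '' A) (sSup (g '' A)) := by
  obtain ⟨x, hxA, hx⟩ := (hg.upperSemicontinuousOn A).exists_isMaxOn hne hA
  have hgx : IsGreatest (g '' A) (g x) := ⟨mem_image_of_mem g hxA, forall_mem_image.2 hx⟩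
  rwa [hgx.csSup_eq]

lemma argmaxOn_eq {g : X → ℝ} (hg : UpperSemicontinuous g) {A : Set X} (hA : IsCompact A) :
    argmaxOn g A = A ∩ {x | sSup (g '' A) ≤ g x} := by
  ext x
  refine and_congr_right fun hx => ?_
  have hmax := isGreatest_sSup_image hg hA ⟨x, hx⟩
  exact ⟨fun h => csSup_le ⟨_, mem_image_of_mem g hx⟩ (forall_mem_image.2 h),
    fun h y hy => (hmax.2 (mem_image_of_mem g hy)).trans h⟩

lemma isCompact_argmaxOn {g : X → ℝ} (hg : UpperSemicontinuous g) {A : Set X}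
    (hA : IsCompact A) : IsCompact (argmaxOn g A) := by
  rw [argmaxOn_eq hg hA]
  exact hA.inter_right (hg.isClosed_preimage _)

lemma argmaxOn_nonempty {g : X → ℝ} (hg : UpperSemicontinuous g) {A : Set X}
    (hA : IsCompact A) (hne : A.Nonempty) : (argmaxOn g A).Nonempty :=
  (hg.upperSemicontinuousOn A).exists_isMaxOn hne hA

lemma argmaxOn_inter_nonempty_iff {g : X → ℝ} (hg : UpperSemicontinuous g) {A F : Set X}
    (hA : IsCompact A) (hF : IsClosed F) :
    (argmaxOn g A ∩ F).Nonempty ↔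
      (A ∩ F).Nonempty ∧ sSup (g '' A) ≤ sSup (g '' (A ∩ F)) := by
  rw [argmaxOn_eq hg hA]
  constructor
  · rintro ⟨x, ⟨hxA, hx⟩, hxF⟩
    have hmax := isGreatest_sSup_image hg (hA.inter_right hF) ⟨x, hxA, hxF⟩
    exact ⟨⟨x, hxA, hxF⟩, le_trans hx (hmax.2 (mem_image_of_mem g ⟨hxA, hxF⟩))⟩
  · rintro ⟨hne, hle⟩
    obtain ⟨x, hx, hgx⟩ := (isGreatest_sSup_image hg (hA.inter_right hF) hne).1
    exact ⟨x, ⟨hx.1, hle.trans hgx.ge⟩, hx.2⟩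

section LexArgmax

variable {g : ℕ → X → ℝ} (hg : ∀ n, UpperSemicontinuous (g n)) {A : Set X} (hA : IsCompact A)

include hg hA

lemma isCompact_lexArgmax (n : ℕ) : IsCompact (lexArgmax g A n) := by
  induction n with
  | zero => exact hA
  | succ n ih => exact isCompact_argmaxOn (hg n) ih

lemma lexArgmax_nonempty (hne : A.Nonempty) (n : ℕ) : (lexArgmax g A n).Nonempty := by
  induction n with
  | zero => exact hne
  | succ n ih => exact argmaxOn_nonempty (hg n) (isCompact_lexArgmax hg hA n) ih

lemma iInter_lexArgmax_inter_nonempty_iff [T2Space X] {F : Set X} (hF : IsClosed F) :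
    ((⋂ n, lexArgmax g A n) ∩ F).Nonempty ↔ ∀ n, (lexArgmax g A n ∩ F).Nonempty := by
  refine ⟨fun h n => h.mono (inter_subset_inter_left F (iInter_subset _ n)), fun h => ?_⟩
  rw [iInter_inter]
  exact IsCompact.nonempty_iInter_of_sequence_nonempty_isCompact_isClosed _
    (fun n => inter_subset_inter_left F fun x hx => hx.1) h (hA.inter_right hF)
    fun n => (isCompact_lexArgmax hg hA n).isClosed.inter hF

end LexArgmax

variable [MeasurableSpace S]

/-- A compact-valued set-valued map that is measurable in the sense that it hits every closed set
on a measurable set of parameters. The values may be empty. -/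
structure IsMeasurableCorrespondence (A : S → Set X) : Prop where
  isCompact : ∀ s, IsCompact (A s)
  measurableSet_inter_nonempty :
    ∀ F : Set X, IsClosed F → MeasurableSet {s | (A s ∩ F).Nonempty}

namespace IsMeasurableCorrespondence

variable {A : S → Set X} (hA : IsMeasurableCorrespondence A)

include hA

lemma inter_isClosed {F : Set X} (hF : IsClosed F) :
    IsMeasurableCorrespondence fun s => A s ∩ F where
  isCompact s := (hA.isCompact s).inter_right hF
  measurableSet_inter_nonempty G hG := by
    simpa only [inter_assoc] using hA.measurableSet_inter_nonempty _ (hF.inter hG)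

lemma image {Y : Type*} [TopologicalSpace Y] {a : X → Y} (ha : Continuous a) :
    IsMeasurableCorrespondence fun s => a '' A s where
  isCompact s := (hA.isCompact s).image ha
  measurableSet_inter_nonempty F hF := by
    simpa only [image_inter_nonempty_iff] using
      hA.measurableSet_inter_nonempty _ (hF.preimage ha)

lemma measurable_sSup_image {g : X → ℝ} (hg : UpperSemicontinuous g) :
    Measurable fun s => sSup (g '' A s) := by
  refine measurable_of_Ici fun c => ?_
  have hset : (fun s => sSup (g '' A s)) ⁻¹' Ici c =
      {s | (A s ∩ {x | c ≤ g x}).Nonempty} ∪ ({s | (A s ∩ univ).Nonempty}ᶜ ∩ {_s | c ≤ 0}) := by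
    ext s
    rcases (A s).eq_empty_or_nonempty with hs | hs
    · simp [hs]
    have hmax := isGreatest_sSup_image hg (hA.isCompact s) hs
    have hle : c ≤ sSup (g '' A s) ↔ (A s ∩ {x | c ≤ g x}).Nonempty := by
      refine ⟨fun hc => ?_, fun ⟨x, hx, hc⟩ => le_trans hc (hmax.2 (mem_image_of_mem g hx))⟩
      obtain ⟨x, hx, hgx⟩ := hmax.1
      exact ⟨x, hx, hc.trans hgx.ge⟩
    simp [hle, hs]
  rw [hset]
  exact (hA.measurableSet_inter_nonempty _ (hg.isClosed_preimage c)).union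
    ((hA.measurableSet_inter_nonempty _ isClosed_univ).compl.inter (.const _))

protected lemma argmaxOn {g : X → ℝ} (hg : UpperSemicontinuous g) :
    IsMeasurableCorrespondence fun s => argmaxOn g (A s) where
  isCompact s := isCompact_argmaxOn hg (hA.isCompact s)
  measurableSet_inter_nonempty F hF := by
    simp only [argmaxOn_inter_nonempty_iff hg (hA.isCompact _) hF]
    exact (hA.measurableSet_inter_nonempty F hF).inter (measurableSet_le
      (hA.measurable_sSup_image hg) ((hA.inter_isClosed hF).measurable_sSup_image hg))

protected lemma lexArgmax {g : ℕ → X → ℝ} (hg : ∀ n, UpperSemicontinuous (g n)) (n : ℕ) :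
    IsMeasurableCorrespondence fun s => lexArgmax g (A s) n := by
  induction n with
  | zero => exact hA
  | succ n ih => exact ih.argmaxOn (hg n)

variable [MeasurableSpace X] [BorelSpace X]

theorem exists_measurable_selection_of_separating [T2Space X] {g : ℕ → X → ℝ}
    (hg : ∀ n, UpperSemicontinuous (g n)) (hsep : ∀ x y, (∀ n, g n x = g n y) → x = y)
    (hne : ∀ s, (A s).Nonempty) : ∃ f : S → X, Measurable f ∧ ∀ s, f s ∈ A s := by
  have hhit s {F : Set X} (hF : IsClosed F) :=
    iInter_lexArgmax_inter_nonempty_iff hg (hA.isCompact s) hF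
  have hne' s : (⋂ n, lexArgmax g (A s) n).Nonempty := by
    simpa only [inter_univ] using (hhit s isClosed_univ).2 fun n => by
      simpa only [inter_univ] using lexArgmax_nonempty hg (hA.isCompact s) (hne s) n
  choose f hf using hne'
  refine ⟨f, measurable_of_isClosed fun F hF => ?_, fun s => mem_iInter.1 (hf s) 0⟩
  have hpre : f ⁻¹' F = ⋂ n, {s | (lexArgmax g (A s) n ∩ F).Nonempty} := by
    ext s
    rw [mem_iInter]
    refine Iff.trans ⟨fun h => ⟨f s, hf s, h⟩, ?_⟩ (hhit s hF)
    rintro ⟨x, hx, hxF⟩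
    rwa [mem_preimage, subsingleton_iInter_lexArgmax hsep (A s) (hf s) hx]
  rw [hpre]
  exact .iInter fun n => (hA.lexArgmax hg n).measurableSet_inter_nonempty F hF

theorem exists_measurable_selection [TopologicalSpace.MetrizableSpace X]
    [SecondCountableTopology X] (hne : ∀ s, (A s).Nonempty) :
    ∃ f : S → X, Measurable f ∧ ∀ s, f s ∈ A s := by
  let _ := TopologicalSpace.metrizableSpaceMetric X
  rcases isEmpty_or_nonempty S with hS | ⟨⟨s₀⟩⟩
  · exact ⟨hS.elim, measurable_of_empty _, hS.elim⟩
  have : Nonempty X := (hne s₀).to_type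
  let d := TopologicalSpace.denseSeq X
  refine hA.exists_measurable_selection_of_separating (g := fun n x => -dist x (d n))
    (fun n => (continuous_id.dist continuous_const).neg.upperSemicontinuous) (fun x y hxy => ?_) hne
  have hdist : (dist x ·) = (dist y ·) :=
    (TopologicalSpace.denseRange_denseSeq X).equalizer (by fun_prop) (by fun_prop)
      (funext fun n => neg_injective (hxy n))
  exact (dist_eq_zero.1 ((congrFun hdist x).symm.trans (dist_self x))).symm

end IsMeasurableCorrespondence

lemma isMeasurableCorrespondence_fiber [TopologicalSpace S] [OpensMeasurableSpace S]
    {p : X → S} (hp : IsProperMap p) : IsMeasurableCorrespondence fun s => p ⁻¹' {s} where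
  isCompact _ := hp.isCompact_preimage isCompact_singleton
  measurableSet_inter_nonempty F hF := by
    convert! (hp.isClosedMap F hF).measurableSet using 1
    ext s
    exact exists_congr fun x => and_comm

end Selection

section BddMeasurable

/-- The bounded measurable real functions. -/
structure BddMeasurable {X : Type*} [MeasurableSpace X] (f : X → ℝ) : Prop where
  measurable : Measurable f
  bounded : ∃ C, ∀ x, |f x| ≤ C

variable {X Y : Type*} [MeasurableSpace X] [MeasurableSpace Y]

namespace BddMeasurable

lemma of_bddAbove_of_bddBelow {f : X → ℝ} (hf : Measurable f) (h_above : BddAbove (range f))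
    (h_below : BddBelow (range f)) : BddMeasurable f := by
  obtain ⟨C, hC⟩ := (Metric.isBounded_of_bddAbove_of_bddBelow h_above h_below).exists_norm_le
  exact ⟨hf, C, fun x => hC _ (mem_range_self x)⟩

variable {f g : X → ℝ}

lemma add (hf : BddMeasurable f) (hg : BddMeasurable g) : BddMeasurable fun x => f x + g x := by
  obtain ⟨C, hC⟩ := hf.bounded
  obtain ⟨D, hD⟩ := hg.bounded
  exact ⟨hf.measurable.add hg.measurable, C + D,
    fun x => (abs_add_le _ _).trans (add_le_add (hC x) (hD x))⟩

lemma const_mul (hf : BddMeasurable f) (c : ℝ) : BddMeasurable fun x => c * f x := by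
  obtain ⟨C, hC⟩ := hf.bounded
  refine ⟨hf.measurable.const_mul c, |c| * C, fun x => ?_⟩
  rw [abs_mul]
  gcongr
  exact hC x

lemma sub (hf : BddMeasurable f) (hg : BddMeasurable g) : BddMeasurable fun x => f x - g x := by
  simpa only [neg_one_mul, sub_eq_add_neg] using hf.add (hg.const_mul (-1))

lemma abs (hf : BddMeasurable f) : BddMeasurable fun x => |f x| :=
  ⟨hf.measurable.abs, hf.bounded.imp fun _ hC x => (abs_abs (f x)).trans_le (hC x)⟩

lemma comp (hf : BddMeasurable f) {a : Y → X} (ha : Measurable a) :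
    BddMeasurable fun y => f (a y) :=
  ⟨hf.measurable.comp ha, hf.bounded.imp fun _ hC y => hC (a y)⟩

lemma integrable (hf : BddMeasurable f) (μ : Measure X) [IsFiniteMeasure μ] : Integrable f μ := by
  obtain ⟨C, hC⟩ := hf.bounded
  exact .of_bound hf.measurable.aestronglyMeasurable C (.of_forall hC)

lemma exists_abs_integral_le (hf : BddMeasurable f) :
    ∃ C, ∀ μ : Measure X, IsProbabilityMeasure μ → |∫ x, f x ∂μ| ≤ C := by
  obtain ⟨C, hC⟩ := hf.bounded
  exact ⟨C, fun μ _ => by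
    simpa using norm_integral_le_of_norm_le_const (μ := μ) (f := f) (.of_forall hC)⟩

lemma integral_kernel (hf : BddMeasurable f) (κ : Kernel Y X) [IsMarkovKernel κ] :
    BddMeasurable fun y => ∫ x, f x ∂(κ y) := by
  obtain ⟨C, hC⟩ := hf.exists_abs_integral_le
  exact ⟨(hf.measurable.stronglyMeasurable.integral_kernel (κ := κ)).measurable, C,
    fun y => hC _ inferInstance⟩

lemma integral_bind (hf : BddMeasurable f) (κ : Kernel Y X) [IsMarkovKernel κ] (μ : Measure Y)
    [IsFiniteMeasure μ] : ∫ x, f x ∂(μ.bind κ) = ∫ y, ∫ x, f x ∂(κ y) ∂μ := by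
  rw [Measure.comp_eq_comp_const_apply, Kernel.integral_comp (hf.integrable _), Kernel.const_apply]

lemma summable_discounted_integral (hf : BddMeasurable f) {α : ℝ} (hα0 : 0 ≤ α) (hα1 : α < 1)
    (μ : ℕ → Measure X) [∀ t, IsProbabilityMeasure (μ t)] :
    Summable fun t => α ^ t * ∫ x, f x ∂(μ t) := by
  obtain ⟨C, hC⟩ := hf.exists_abs_integral_le
  refine .of_norm_bounded ((summable_geometric_of_lt_one hα0 hα1).mul_right C) fun t => ?_
  rw [norm_mul, norm_pow, Real.norm_of_nonneg hα0]
  gcongr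
  exact hC _ inferInstance

end BddMeasurable

open scoped UniformConvergence in
lemma isClosed_setOf_bddMeasurable :
    IsClosed {f : X →ᵤ ℝ | BddMeasurable (UniformFun.toFun f)} := by
  refine isSeqClosed_iff_isClosed.1 fun u f hu hlim => ?_
  have hunif := UniformFun.tendsto_iff_tendstoUniformly.1 hlim
  refine ⟨measurable_of_tendsto_metrizable (fun n => (hu n).measurable)
    (tendsto_pi_nhds.2 hunif.tendsto_at), ?_⟩
  obtain ⟨n, hn⟩ := (Metric.tendstoUniformly_iff.1 hunif 1 one_pos).exists
  obtain ⟨C, hC⟩ := (hu n).bounded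
  refine ⟨1 + C, fun x => ?_⟩
  calc |UniformFun.toFun f x|
      ≤ |UniformFun.toFun f x - UniformFun.toFun (u n) x| + |UniformFun.toFun (u n) x| := by
        simpa using abs_add_le (UniformFun.toFun f x - UniformFun.toFun (u n) x)
          (UniformFun.toFun (u n) x)
    _ ≤ 1 + C := add_le_add (hn x).le (hC x)

end BddMeasurable

open scoped UniformConvergence in
theorem exists_fixedPoint_of_uniform_contraction {X E : Type*} [MetricSpace E] [CompleteSpace E]
    {F : Set (X → E)} (hF : IsClosed {f : X →ᵤ E | UniformFun.toFun f ∈ F}) (hne : F.Nonempty)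
    (hbdd : ∀ f ∈ F, ∀ g ∈ F, ∃ D, ∀ x, dist (f x) (g x) ≤ D) {T : (X → E) → X → E}
    (hT : MapsTo T F F) {α : ℝ} (hα0 : 0 ≤ α) (hα1 : α < 1)
    (hcontr : ∀ f ∈ F, ∀ g ∈ F, ∀ D, (∀ x, dist (f x) (g x) ≤ D) →
      ∀ x, dist (T f x) (T g x) ≤ α * D) :
    ∃ f ∈ F, T f = f := by
  lift α to NNReal using hα0
  let T' : (X →ᵤ E) → (X →ᵤ E) := fun f => UniformFun.ofFun (T (UniformFun.toFun f))
  have hfin {f g : X →ᵤ E} (hf : UniformFun.toFun f ∈ F) (hg : UniformFun.toFun g ∈ F) :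
      edist f g ≠ ⊤ := by
    obtain ⟨D, hD⟩ := hbdd _ hf _ hg
    refine ((UniformFun.edist_le (C := ENNReal.ofReal D)).2 fun x => ?_).trans_lt
      ENNReal.ofReal_lt_top |>.ne
    rw [edist_dist]
    exact ENNReal.ofReal_le_ofReal (hD x)
  have hlip : LipschitzOnWith α T' {f | UniformFun.toFun f ∈ F} := by
    intro f hf g hg
    have hD x : dist (UniformFun.toFun f x) (UniformFun.toFun g x) ≤ (edist f g).toReal := by
      rw [dist_edist]
      exact ENNReal.toReal_mono (hfin hf hg) UniformFun.edist_eval_le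
    refine UniformFun.edist_le.2 fun x => ?_
    calc edist (T (UniformFun.toFun f) x) (T (UniformFun.toFun g) x)
        ≤ ENNReal.ofReal (α * (edist f g).toReal) := by
          rw [edist_dist]
          exact ENNReal.ofReal_le_ofReal (hcontr _ hf _ hg _ hD x)
      _ = α * edist f g := by
          rw [ENNReal.ofReal_mul α.coe_nonneg, ENNReal.ofReal_toReal (hfin hf hg),
            ENNReal.ofReal_coe_nnreal]
  have hT' : MapsTo T' {f | UniformFun.toFun f ∈ F} {f | UniformFun.toFun f ∈ F} :=
    fun f hf => hT hf
  obtain ⟨f₀, hf₀⟩ := hne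
  obtain ⟨f, hf, hfix, -⟩ := ContractingWith.exists_fixedPoint' (K := α) hF.isComplete hT'
    ⟨hα1, hlip.mapsToRestrict hT'⟩ (x := UniformFun.ofFun f₀) hf₀ (hfin hf₀ (hT hf₀))
  exact ⟨UniformFun.toFun f, hf, hfix⟩

lemma abs_ciSup_sub_ciSup_le {ι : Type*} [Nonempty ι] {f g : ι → ℝ} (hf : BddAbove (range f))
    (hg : BddAbove (range g)) {D : ℝ} (h : ∀ i, |f i - g i| ≤ D) :
    |(⨆ i, f i) - ⨆ i, g i| ≤ D := by
  refine abs_sub_le_iff.2 ⟨sub_le_iff_le_add.2 (ciSup_le fun i => ?_),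
    sub_le_iff_le_add.2 (ciSup_le fun i => ?_)⟩
  · linarith [le_ciSup hg i, (abs_sub_le_iff.1 (h i)).1]
  · linarith [le_ciSup hf i, (abs_sub_le_iff.1 (h i)).2]

lemma bind_map_eq_bind_comap {X Y Z : Type*} [MeasurableSpace X] [MeasurableSpace Y]
    [MeasurableSpace Z] (μ : Measure X) {a : X → Y} (ha : Measurable a) (κ : Kernel Y Z) :
    (μ.map a).bind κ = μ.bind (κ.comap a ha) := by
  rw [← Measure.deterministic_comp_eq_map ha, Measure.comp_assoc,
    Kernel.comp_deterministic_eq_comap]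

namespace MDP

variable {S U : Type*} [MeasurableSpace S] [MeasurableSpace U] {M : MDP S U}

/-- The state of a feasible state-action pair. -/
def state (k : M.K) : S := k.1.1

/-- The action of a feasible state-action pair. -/
def action (k : M.K) : U := k.1.2

lemma measurable_state : Measurable (state (M := M)) :=
  measurable_fst.comp measurable_subtype_coe

lemma range_pair (s : S) : range (M.pair s) = state ⁻¹' {s} := by
  ext k
  constructor
  · rintro ⟨u, rfl⟩
    rfl
  · rintro rfl
    exact ⟨⟨action k, k.2⟩, rfl⟩

lemma state_preimage_singleton_nonempty (s : S) : (state (M := M) ⁻¹' {s}).Nonempty := by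
  have := (M.feasible_nonempty s).to_subtype
  rw [← range_pair]
  exact range_nonempty _

section Bellman

variable {α : ℝ} {V : S → ℝ}

lemma bddMeasurable_qValue (hr : BddMeasurable M.r) (α : ℝ) (hV : BddMeasurable V) :
    BddMeasurable (M.qValue α V) :=
  hr.add ((hV.integral_kernel M.Q).const_mul α)

lemma range_qValue_pair (s : S) :
    range (fun u => M.qValue α V (M.pair s u)) = M.qValue α V '' (state ⁻¹' {s}) := by
  rw [← range_pair, ← range_comp, Function.comp_def]

lemma maximizers_eq_image_argmaxOn (s : S) :
    M.maximizers α V s = action '' argmaxOn (M.qValue α V) (state ⁻¹' {s}) := by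
  ext u
  simp only [argmaxOn, isMaxOn_iff, ← range_pair, forall_mem_range]
  constructor
  · rintro ⟨hu, hmax⟩
    exact ⟨M.pair s ⟨u, hu⟩, ⟨⟨⟨u, hu⟩, rfl⟩, hmax⟩, rfl⟩
  · rintro ⟨_, ⟨⟨u', rfl⟩, hmax⟩, rfl⟩
    exact ⟨u'.2, hmax⟩

/-- The Bellman operator `V ↦ sup_{u ∈ U(s)} (r(s,u) + α 𝔼_Q[V(s') | s,u])`. The supremum is
meaningful only if it is taken over a bounded set, as for bounded `r` and `V`. -/
noncomputable def bellmanOp (M : MDP S U) (α : ℝ) (V : S → ℝ) (s : S) : ℝ :=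
  ⨆ u : M.feasible s, M.qValue α V (M.pair s u)

lemma abs_qValue_sub_le (hα0 : 0 ≤ α) {W : S → ℝ} (hV : BddMeasurable V) (hW : BddMeasurable W)
    {D : ℝ} (hD : ∀ s, |V s - W s| ≤ D) (k : M.K) :
    |M.qValue α V k - M.qValue α W k| ≤ α * D := by
  have hint : |∫ s, (V s - W s) ∂(M.Q k)| ≤ D := by
    simpa using norm_integral_le_of_norm_le_const (μ := M.Q k) (f := fun s => V s - W s)
      (.of_forall hD)
  calc |M.qValue α V k - M.qValue α W k|
      = α * |∫ s, (V s - W s) ∂(M.Q k)| := by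
        rw [qValue, qValue, add_sub_add_left_eq_sub, ← mul_sub,
          ← integral_sub (hV.integrable _) (hW.integrable _), abs_mul, abs_of_nonneg hα0]
    _ ≤ α * D := by gcongr

lemma abs_bellmanOp_sub_le (hα0 : 0 ≤ α) (hr : BddMeasurable M.r) {W : S → ℝ}
    (hV : BddMeasurable V) (hW : BddMeasurable W) {D : ℝ} (hD : ∀ s, |V s - W s| ≤ D) (s : S) :
    |M.bellmanOp α V s - M.bellmanOp α W s| ≤ α * D := by
  have := (M.feasible_nonempty s).to_subtype
  have hbdd {V' : S → ℝ} (hV' : BddMeasurable V') :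
      BddAbove (range fun u => M.qValue α V' (M.pair s u)) := by
    obtain ⟨C, hC⟩ := (bddMeasurable_qValue hr α hV').bounded
    exact ⟨C, forall_mem_range.2 fun u => (le_abs_self _).trans (hC _)⟩
  exact abs_ciSup_sub_ciSup_le (hbdd hV) (hbdd hW) fun u => abs_qValue_sub_le hα0 hV hW hD _

/-- A bounded measurable function that satisfies the optimality equation with the supremum attained
in every state. -/
structure IsBellmanSolution (M : MDP S U) (α : ℝ) (V : S → ℝ) : Prop where
  bddMeasurable : BddMeasurable V
  isGreatest : ∀ s, IsGreatest (range fun u => M.qValue α V (M.pair s u)) (V s)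

section Topology

variable [TopologicalSpace S] [TopologicalSpace U]

lemma continuous_state : Continuous (state (M := M)) :=
  continuous_fst.comp continuous_subtype_val

lemma continuous_action : Continuous (action (M := M)) :=
  continuous_snd.comp continuous_subtype_val

lemma isProperMap_state [TopologicalSpace.MetrizableSpace S]
    (h_cpt : ∀ C : Set S, IsCompact C →
      IsCompact {p : S × U | p.1 ∈ C ∧ p.2 ∈ M.feasible p.1}) :
    IsProperMap (state (M := M)) := by
  refine isProperMap_iff_isCompact_preimage.2 ⟨continuous_state, fun C hC => ?_⟩
  rw [Subtype.isCompact_iff]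
  convert! h_cpt C hC using 1
  ext p
  exact ⟨by rintro ⟨k, hk, rfl⟩; exact ⟨hk, k.2⟩, fun hp => ⟨⟨p, hp.2⟩, hp.1, rfl⟩⟩

lemma upperSemicontinuous_qValue (h_usc : UpperSemicontinuous M.r)
    (h_Q : M.StronglyContinuous) (hV : BddMeasurable V) :
    UpperSemicontinuous (M.qValue α V) :=
  h_usc.add (continuous_const.mul (h_Q V hV.measurable hV.bounded)).upperSemicontinuous

section Proper

variable (h_usc : UpperSemicontinuous M.r) (h_Q : M.StronglyContinuous)
  (hp : IsProperMap (state (M := M))) (hV : BddMeasurable V)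

include h_usc h_Q hp hV

lemma isGreatest_bellmanOp (s : S) :
    IsGreatest (range fun u => M.qValue α V (M.pair s u)) (M.bellmanOp α V s) := by
  rw [bellmanOp, ← sSup_range, range_qValue_pair]
  exact isGreatest_sSup_image (upperSemicontinuous_qValue h_usc h_Q hV)
    (hp.isCompact_preimage isCompact_singleton) (state_preimage_singleton_nonempty s)

variable [OpensMeasurableSpace S]

lemma bddMeasurable_bellmanOp (hr : BddMeasurable M.r) : BddMeasurable (M.bellmanOp α V) := by
  constructor
  · have hfiber := isMeasurableCorrespondence_fiber hp
    convert! hfiber.measurable_sSup_image (upperSemicontinuous_qValue h_usc h_Q hV) using 2 with s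
    rw [← range_qValue_pair, sSup_range, bellmanOp]
  · obtain ⟨C, hC⟩ := (bddMeasurable_qValue hr α hV).bounded
    refine ⟨C, fun s => ?_⟩
    obtain ⟨u, hu⟩ := (isGreatest_bellmanOp (α := α) h_usc h_Q hp hV s).1
    exact hu ▸ hC _

lemma exists_measurable_maximizer [TopologicalSpace.MetrizableSpace U] [SecondCountableTopology U]
    [BorelSpace U] : ∃ f : S → U, Measurable f ∧ ∀ s, f s ∈ M.maximizers α V s := by
  have hq := upperSemicontinuous_qValue (α := α) h_usc h_Q hV
  simp only [maximizers_eq_image_argmaxOn]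
  exact ((isMeasurableCorrespondence_fiber hp).argmaxOn hq).image continuous_action
    |>.exists_measurable_selection fun s => (argmaxOn_nonempty hq
      (hp.isCompact_preimage isCompact_singleton) (state_preimage_singleton_nonempty s)).image _

end Proper

theorem exists_isBellmanSolution [OpensMeasurableSpace S] (hα0 : 0 ≤ α) (hα1 : α < 1)
    (hr : BddMeasurable M.r) (h_usc : UpperSemicontinuous M.r) (h_Q : M.StronglyContinuous)
    (hp : IsProperMap (state (M := M))) : ∃ V, M.IsBellmanSolution α V := by
  obtain ⟨V, hV, hfix⟩ := exists_fixedPoint_of_uniform_contraction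
    (F := {V : S → ℝ | BddMeasurable V}) (T := M.bellmanOp α) isClosed_setOf_bddMeasurable
    ⟨fun _ => 0, measurable_const, 0, by simp⟩ (fun V hV W hW => (hV.sub hW).bounded)
    (fun V hV => bddMeasurable_bellmanOp h_usc h_Q hp hV hr) hα0 hα1
    (fun V hV W hW D => abs_bellmanOp_sub_le hα0 hr hV hW)
  have hmax := isGreatest_bellmanOp (α := α) h_usc h_Q hp hV
  rw [hfix] at hmax
  exact ⟨V, hV, hmax⟩

end Topology

end Bellman

end MDP

namespace MDP

variable {S U : Type*} [MeasurableSpace S] [MeasurableSpace U] {M : MDP S U}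

section Flow

variable {α : ℝ} {V : S → ℝ}

/-- Mandl's discrepancy function: for a solution `V` of the optimality equations, what is lost by
choosing the action of `k` and proceeding optimally afterwards. -/
noncomputable def discrepancy (M : MDP S U) (α : ℝ) (V : S → ℝ) (k : M.K) : ℝ :=
  V (state k) - M.qValue α V k

lemma bddMeasurable_discrepancy (hr : BddMeasurable M.r) (α : ℝ) (hV : BddMeasurable V) :
    BddMeasurable (M.discrepancy α V) :=
  (hV.comp measurable_state).sub (bddMeasurable_qValue hr α hV)

lemma integral_reward_eq (hr : BddMeasurable M.r) (α : ℝ) (hV : BddMeasurable V)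
    (μ : Measure M.K) [IsProbabilityMeasure μ] :
    ∫ k, M.r k ∂μ = ∫ s, V s ∂(μ.map state) - α * ∫ s, V s ∂(μ.bind M.Q) -
      ∫ k, M.discrepancy α V k ∂μ := by
  have hq : ∫ k, M.qValue α V k ∂μ = ∫ k, M.r k ∂μ + α * ∫ s, V s ∂(μ.bind M.Q) := by
    rw [hV.integral_bind, ← integral_const_mul, ← integral_add (hr.integrable μ)
      (((hV.integral_kernel M.Q).const_mul α).integrable μ)]
    rfl
  have hd : ∫ k, M.discrepancy α V k ∂μ =
      ∫ s, V s ∂(μ.map state) - ∫ k, M.qValue α V k ∂μ := by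
    rw [integral_map measurable_state.aemeasurable hV.measurable.aestronglyMeasurable,
      ← integral_sub ((hV.comp measurable_state).integrable μ)
        ((bddMeasurable_qValue hr α hV).integrable μ)]
    rfl
  rw [hd, hq]
  ring

/-- A sequence of laws of state-action pairs in which the law of each state is the one that the
transition kernel produces from the preceding pair. -/
structure IsFlow (M : MDP S U) (μ : ℕ → Measure M.K) : Prop where
  prob : ∀ t, IsProbabilityMeasure (μ t)
  map_state_succ : ∀ t, (μ (t + 1)).map state = (μ t).bind M.Q

lemma IsFlow.tsum_reward_eq {μ : ℕ → Measure M.K} (hμ : M.IsFlow μ) (hα0 : 0 ≤ α) (hα1 : α < 1)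
    (hr : BddMeasurable M.r) (hV : BddMeasurable V) :
    ∑' t, α ^ t * ∫ k, M.r k ∂(μ t) =
      ∫ s, V s ∂((μ 0).map state) - ∑' t, α ^ t * ∫ k, M.discrepancy α V k ∂(μ t) := by
  have := hμ.prob
  have := fun t => Measure.isProbabilityMeasure_map (μ := μ t) measurable_state.aemeasurable
  have hv := hV.summable_discounted_integral hα0 hα1 fun t => (μ t).map state
  have hd := (bddMeasurable_discrepancy hr α hV).summable_discounted_integral hα0 hα1 μ
  have hterm t : α ^ t * ∫ k, M.r k ∂(μ t) =
      α ^ t * ∫ s, V s ∂((μ t).map state) - α ^ (t + 1) * ∫ s, V s ∂((μ (t + 1)).map state) -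
        α ^ t * ∫ k, M.discrepancy α V k ∂(μ t) := by
    rw [integral_reward_eq hr α hV, hμ.map_state_succ]
    ring
  rw [tsum_congr hterm, (hv.sub ((summable_nat_add_iff 1).2 hv)).tsum_sub hd,
    hv.tsum_sub ((summable_nat_add_iff 1).2 hv), hv.tsum_eq_zero_add]
  ring

namespace IsBellmanSolution

variable (hV : M.IsBellmanSolution α V)

include hV

lemma discrepancy_nonneg (k : M.K) : 0 ≤ M.discrepancy α V k :=
  sub_nonneg.2 ((hV.isGreatest (state k)).2 ⟨⟨action k, k.2⟩, rfl⟩)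

lemma mem_maximizers_iff {s : S} {u : U} : u ∈ M.maximizers α V s ↔
    ∃ hu : u ∈ M.feasible s, M.discrepancy α V (M.pair s ⟨u, hu⟩) = 0 := by
  refine exists_congr fun hu => ?_
  obtain ⟨u₀, hu₀⟩ := (hV.isGreatest s).1
  have hle u' : M.qValue α V (M.pair s u') ≤ V s := (hV.isGreatest s).2 ⟨u', rfl⟩
  rw [discrepancy, sub_eq_zero]
  exact ⟨fun h => le_antisymm (hu₀.ge.trans (h u₀)) (hle _), fun h u' => (hle u').trans h.le⟩

variable {μ : ℕ → Measure M.K} (hμ : M.IsFlow μ) (hα0 : 0 ≤ α) (hα1 : α < 1)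
  (hr : BddMeasurable M.r)

include hμ hα0 hα1 hr

lemma tsum_reward_le : ∑' t, α ^ t * ∫ k, M.r k ∂(μ t) ≤ ∫ s, V s ∂((μ 0).map state) := by
  rw [hμ.tsum_reward_eq hα0 hα1 hr hV.bddMeasurable]
  exact sub_le_self _ (tsum_nonneg fun t =>
    mul_nonneg (pow_nonneg hα0 t) (integral_nonneg hV.discrepancy_nonneg))

lemma tsum_reward_eq (h : ∀ t, ∀ᵐ k ∂(μ t), M.discrepancy α V k = 0) :
    ∑' t, α ^ t * ∫ k, M.r k ∂(μ t) = ∫ s, V s ∂((μ 0).map state) := by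
  simp [hμ.tsum_reward_eq hα0 hα1 hr hV.bddMeasurable, fun t => integral_eq_zero_of_ae (h t)]

end IsBellmanSolution

end Flow

section PairKernel

variable {X : Type*} [MeasurableSpace X]

lemma pairKernel_apply' (σ : X → S) (hσ : Measurable σ) (κ : Kernel X U) [IsSFiniteKernel κ]
    (x : X) {A : Set M.K} (hA : MeasurableSet A) :
    M.pairKernel σ hσ κ x A = κ x {u | ∃ hu : u ∈ M.feasible (σ x), M.pair (σ x) ⟨u, hu⟩ ∈ A} := by
  have he := MeasurableEmbedding.subtype_coe M.measurableSet_graph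
  rw [pairKernel, Kernel.comapRight_apply' _ he _ hA, Kernel.prod_apply,
    Kernel.deterministic_apply, Measure.dirac_prod,
    Measure.map_apply measurable_prodMk_left (he.measurableSet_image' hA)]
  congr 1
  ext u
  constructor
  · rintro ⟨⟨⟨s, u'⟩, hu⟩, hk, h⟩
    obtain ⟨rfl, rfl⟩ := Prod.mk.inj h
    exact ⟨hu, hk⟩
  · rintro ⟨hu, hk⟩
    exact ⟨_, hk, rfl⟩

lemma map_state_pairKernel (σ : X → S) (hσ : Measurable σ) (κ : Kernel X U) [IsMarkovKernel κ]
    (hκ : ∀ x, κ x (M.feasible (σ x)) = 1) :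
    (M.pairKernel σ hσ κ).map state = Kernel.deterministic σ hσ := by
  ext x B hB
  rw [Kernel.map_apply' _ measurable_state _ hB, pairKernel_apply' _ _ _ _ (measurable_state hB),
    Kernel.deterministic_apply' _ _ hB]
  by_cases h : σ x ∈ B
  · simpa [pair, state, h] using hκ x
  · simp [pair, state, h]

lemma map_state_bind_pairKernel (μ : Measure X) (σ : X → S) (hσ : Measurable σ) (κ : Kernel X U)
    [IsMarkovKernel κ] (hκ : ∀ x, κ x (M.feasible (σ x)) = 1) :
    (μ.bind (M.pairKernel σ hσ κ)).map state = μ.map σ := by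
  rw [Measure.map_comp _ _ measurable_state, map_state_pairKernel _ _ _ hκ,
    Measure.deterministic_comp_eq_map]

end PairKernel

namespace Policy

/-- The law of `(s_t, u_t)` under a policy. -/
noncomputable def marginal (π : M.Policy) (ν : Measure S) (t : ℕ) : Measure M.K :=
  (π.law ν).map fun ω => ω t

/-- The law of the history `(s₀, u₀, …, s_{t-1}, u_{t-1}, s_t)` under a policy. -/
noncomputable def historyLaw (π : M.Policy) (ν : Measure S) :
    (t : ℕ) → Measure ((Fin t → M.K) × S)
  | 0 => ν.map fun s => (fun i => i.elim0, s)
  | t + 1 => ((π.law ν).map (Preorder.frestrictLe t)).bind (M.historyStep t)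

variable (π : M.Policy) (ν : Measure S)

lemma marginal_zero : π.marginal ν 0 = π.initialLaw ν := by
  have h : (fun ω : ℕ → M.K => ω 0) = (MeasurableEquiv.piUnique fun _ : Finset.Iic 0 => M.K) ∘
      Preorder.frestrictLe 0 := rfl
  rw [marginal, law, Kernel.trajMeasure, h, ← Measure.map_map (by fun_prop) (by fun_prop),
    Measure.map_comp _ _ (by fun_prop), Kernel.traj_map_frestrictLe, Kernel.partialTraj_self,
    Measure.id_comp, Measure.map_map (by fun_prop) (by fun_prop)]
  convert Measure.map_id
  exact funext fun x => MeasurableEquiv.apply_symm_apply _ x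

variable [IsProbabilityMeasure ν]

instance : IsProbabilityMeasure (π.initialLaw ν) := by
  unfold initialLaw
  have : IsProbabilityMeasure (ν.map fun s => ((fun i => i.elim0 : Fin 0 → M.K), s)) :=
    Measure.isProbabilityMeasure_map (by fun_prop)
  infer_instance

instance : IsProbabilityMeasure (π.law ν) := by
  unfold law; infer_instance

instance (t : ℕ) : IsProbabilityMeasure (π.marginal ν t) :=
  Measure.isProbabilityMeasure_map (measurable_pi_apply t).aemeasurable

lemma marginal_succ (t : ℕ) : π.marginal ν (t + 1) =
    ((π.law ν).map (Preorder.frestrictLe t)).bind (π.step t) := by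
  have h := congrArg Measure.snd (Kernel.map_frestrictLe_trajMeasure_compProd_eq_map_trajMeasure
    (X := fun _ => M.K) (κ := π.step) (μ₀ := π.initialLaw ν) (a := t))
  have : IsProbabilityMeasure ((π.law ν).map (Preorder.frestrictLe (π := fun _ => M.K) t)) :=
    Measure.isProbabilityMeasure_map (by fun_prop)
  rw [Measure.snd_compProd, Measure.snd_map_prodMk (by fun_prop)] at h
  exact h.symm

lemma marginal_eq (t : ℕ) : π.marginal ν t = (π.historyLaw ν t).bind (π.pairLaw t) := by
  cases t with
  | zero => exact π.marginal_zero ν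
  | succ t => rw [π.marginal_succ, step, ← Measure.comp_assoc, historyLaw]

lemma map_state_marginal (t : ℕ) :
    (π.marginal ν t).map state = (π.historyLaw ν t).map Prod.snd := by
  have := π.markov t
  rw [π.marginal_eq, pairLaw, map_state_bind_pairKernel _ _ _ _ (π.feasible t)]

lemma map_state_marginal_zero : (π.marginal ν 0).map state = ν := by
  rw [π.map_state_marginal, historyLaw, Measure.map_map measurable_snd (by fun_prop)]
  exact Measure.map_id

lemma isFlow_marginal : M.IsFlow (π.marginal ν) where
  prob _ := inferInstance
  map_state_succ t := by
    have hlast : π.marginal ν t = ((π.law ν).map (Preorder.frestrictLe t)).map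
        fun h => h ⟨t, Finset.mem_Iic.2 le_rfl⟩ := by
      rw [Measure.map_map (by fun_prop) (by fun_prop)]
      rfl
    rw [π.map_state_marginal, historyLaw, Measure.map_comp _ _ measurable_snd, ← Kernel.snd_eq,
      historyStep, Kernel.snd_prod, hlast]
    exact (bind_map_eq_bind_comap _ _ _).symm

lemma value_eq_tsum {α : ℝ} (hα0 : 0 ≤ α) (hα1 : α < 1) (hr : BddMeasurable M.r) (s : S) :
    π.value α s = ∑' t, α ^ t * ∫ k, M.r k ∂(π.marginal (Measure.dirac s) t) := by
  have hmap {g : M.K → ℝ} (hg : BddMeasurable g) t :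
      ∫ ω, α ^ t * g (ω t) ∂(π.law (Measure.dirac s)) =
        α ^ t * ∫ k, g k ∂(π.marginal (Measure.dirac s) t) := by
    rw [integral_const_mul, marginal, integral_map (measurable_pi_apply t).aemeasurable
      hg.measurable.aestronglyMeasurable]
  have hint t : Integrable (fun ω : ℕ → M.K => α ^ t * M.r (ω t)) (π.law (Measure.dirac s)) :=
    ((hr.comp (measurable_pi_apply t)).const_mul _).integrable _
  have hnorm : Summable fun t => ∫ ω, ‖α ^ t * M.r (ω t)‖ ∂(π.law (Measure.dirac s)) := by
    simp only [norm_mul, norm_pow, Real.norm_of_nonneg hα0, Real.norm_eq_abs, hmap hr.abs]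
    exact hr.abs.summable_discounted_integral hα0 hα1 _
  simp only [value, totalReward]
  rw [← integral_tsum_of_summable_integral_norm hint hnorm]
  exact tsum_congr (hmap hr)

end Policy

end MDP

namespace MDP

variable {S U : Type*} [MeasurableSpace S] [MeasurableSpace U] {M : MDP S U}

namespace DecisionRule

/-- The law of the state-action pair when the state has law `ν` and the action is drawn from the
decision rule `φ`. -/
noncomputable def jointLaw (φ : M.DecisionRule) (ν : Measure S) : Measure M.K :=
  ν.bind φ.pairLaw

instance (φ : M.DecisionRule) (ν : Measure S) [IsProbabilityMeasure ν] :
    IsProbabilityMeasure (φ.jointLaw ν) := by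
  unfold jointLaw; infer_instance

lemma map_state_jointLaw (φ : M.DecisionRule) (ν : Measure S) :
    (φ.jointLaw ν).map state = ν := by
  have := φ.markov
  rw [jointLaw, pairLaw, map_state_bind_pairKernel _ id _ _ φ.feasible]
  exact Measure.map_id

/-- The stationary policy of a decision rule. -/
noncomputable def policy (φ : M.DecisionRule) : M.Policy where
  toKernel _ := φ.toKernel.comap Prod.snd measurable_snd
  markov _ := have := φ.markov; inferInstance
  feasible _ h := φ.feasible h.2

lemma policy_pairLaw (φ : M.DecisionRule) (t : ℕ) :
    φ.policy.pairLaw t = φ.pairLaw.comap Prod.snd measurable_snd := by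
  have := φ.markov
  have := φ.policy.markov t
  ext h A hA
  rw [Policy.pairLaw, Kernel.comap_apply, DecisionRule.pairLaw, pairKernel_apply' _ _ _ _ hA,
    pairKernel_apply' _ _ _ _ hA]
  rfl

lemma marginal_policy (φ : M.DecisionRule) (ν : Measure S) [IsProbabilityMeasure ν] (t : ℕ) :
    φ.policy.marginal ν t = φ.jointLaw ((φ.policy.marginal ν t).map state) := by
  rw [Policy.map_state_marginal, jointLaw, bind_map_eq_bind_comap _ measurable_snd,
    ← policy_pairLaw, Policy.marginal_eq]

end DecisionRule

lemma coe_liftedStep (ν : ProbabilityMeasure S) (φ : M.DecisionRule) :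
    (M.liftedStep ν φ : Measure S) = (φ.jointLaw ν).bind M.Q :=
  Measure.comp_assoc.symm

lemma isFlow_jointLaw_liftedPath (ν : ProbabilityMeasure S) (φ : ℕ → M.DecisionRule) :
    M.IsFlow fun t => (φ t).jointLaw (M.liftedPath ν φ t) where
  prob _ := inferInstance
  map_state_succ t := by
    rw [DecisionRule.map_state_jointLaw, liftedPath, coe_liftedStep]

lemma liftedReward_eq (hr : BddMeasurable M.r) (ν : ProbabilityMeasure S)
    (φ : M.DecisionRule) : M.liftedReward ν φ = ∫ k, M.r k ∂(φ.jointLaw ν) :=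
  (hr.integral_bind _ _).symm

namespace IsBellmanSolution

variable {α : ℝ} {V : S → ℝ} (hV : M.IsBellmanSolution α V) (hr : BddMeasurable M.r)

include hV hr

lemma pairLaw_ae_iff (φ : M.DecisionRule) (s : S) :
    (∀ᵐ k ∂(φ.pairLaw s), M.discrepancy α V k = 0) ↔ φ.toKernel s (M.maximizers α V s) = 1 := by
  have := φ.markov
  have hmeas : MeasurableSet {k | M.discrepancy α V k = 0} :=
    (bddMeasurable_discrepancy hr α hV.bddMeasurable).measurable (measurableSet_singleton 0)
  have hset : M.maximizers α V s = {u | ∃ hu : u ∈ M.feasible s,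
      M.pair s ⟨u, hu⟩ ∈ {k | M.discrepancy α V k = 0}} :=
    Set.ext fun _ => hV.mem_maximizers_iff
  rw [hset]
  exact (mem_ae_iff_prob_eq_one hmeas).trans
    (Eq.congr_left (pairKernel_apply' id measurable_id φ.toKernel s hmeas))

lemma jointLaw_ae_iff (φ : M.DecisionRule) (ν : Measure S) :
    (∀ᵐ k ∂(φ.jointLaw ν), M.discrepancy α V k = 0) ↔
      ∀ᵐ s ∂ν, φ.toKernel s (M.maximizers α V s) = 1 := by
  simp only [← hV.pairLaw_ae_iff hr]
  exact Measure.ae_comp_iff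
    ((bddMeasurable_discrepancy hr α hV.bddMeasurable).measurable (measurableSet_singleton 0))

variable (hα0 : 0 ≤ α) (hα1 : α < 1) {φ₀ : M.DecisionRule}
  (hφ₀ : ∀ s, φ₀.toKernel s (M.maximizers α V s) = 1)

include hα0 hα1 hφ₀

theorem optValue_eq : M.optValue α = V := by
  ext s
  have hstart (π : M.Policy) : ∫ s', V s' ∂((π.marginal (Measure.dirac s) 0).map state) = V s := by
    rw [π.map_state_marginal_zero,
      integral_dirac' _ _ hV.bddMeasurable.measurable.stronglyMeasurable]
  refine IsGreatest.csSup_eq ⟨⟨φ₀.policy, ?_⟩, forall_mem_range.2 fun π => ?_⟩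
  · have hzero t : ∀ᵐ k ∂(φ₀.policy.marginal (Measure.dirac s) t), M.discrepancy α V k = 0 := by
      rw [φ₀.marginal_policy, hV.jointLaw_ae_iff hr]
      exact .of_forall hφ₀
    change φ₀.policy.value α s = V s
    rw [Policy.value_eq_tsum _ hα0 hα1 hr,
      hV.tsum_reward_eq (Policy.isFlow_marginal _ _) hα0 hα1 hr hzero, hstart]
  · rw [π.value_eq_tsum hα0 hα1 hr, ← hstart π]
    exact hV.tsum_reward_le (π.isFlow_marginal _) hα0 hα1 hr

theorem liftedOptValue_eq (ν : ProbabilityMeasure S) :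
    M.liftedOptValue α ν = ∫ s, V s ∂(ν : Measure S) := by
  have hstart (φ : ℕ → M.DecisionRule) :
      ((φ 0).jointLaw (M.liftedPath ν φ 0)).map state = (ν : Measure S) :=
    (φ 0).map_state_jointLaw _
  simp only [liftedOptValue, liftedReward_eq hr]
  refine IsGreatest.csSup_eq ⟨⟨fun _ => φ₀, ?_⟩, forall_mem_range.2 fun φ => ?_⟩
  · rw [← hstart fun _ => φ₀]
    exact hV.tsum_reward_eq (isFlow_jointLaw_liftedPath ν _) hα0 hα1 hr
      fun t => (hV.jointLaw_ae_iff hr φ₀ _).2 (.of_forall hφ₀)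
  · rw [← hstart φ]
    exact hV.tsum_reward_le (isFlow_jointLaw_liftedPath ν φ) hα0 hα1 hr

lemma liftedQValue_eq (ν : ProbabilityMeasure S) (φ : M.DecisionRule) :
    M.liftedQValue α (M.liftedOptValue α) ν φ =
      M.liftedOptValue α ν - ∫ k, M.discrepancy α V k ∂(φ.jointLaw ν) := by
  rw [liftedQValue, hV.liftedOptValue_eq hr hα0 hα1 hφ₀, hV.liftedOptValue_eq hr hα0 hα1 hφ₀,
    liftedReward_eq hr, integral_reward_eq hr α hV.bddMeasurable, φ.map_state_jointLaw,
    coe_liftedStep]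
  ring

lemma liftedQValue_le (ν : ProbabilityMeasure S) (φ : M.DecisionRule) :
    M.liftedQValue α (M.liftedOptValue α) ν φ ≤ M.liftedOptValue α ν := by
  rw [hV.liftedQValue_eq hr hα0 hα1 hφ₀]
  exact sub_le_self _ (integral_nonneg hV.discrepancy_nonneg)

lemma liftedQValue_eq_liftedOptValue_iff (ν : ProbabilityMeasure S) (φ : M.DecisionRule) :
    M.liftedQValue α (M.liftedOptValue α) ν φ = M.liftedOptValue α ν ↔
      ∀ᵐ s ∂(ν : Measure S), φ.toKernel s (M.maximizers α V s) = 1 := by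
  rw [hV.liftedQValue_eq hr hα0 hα1 hφ₀, sub_eq_self, ← hV.jointLaw_ae_iff hr]
  exact integral_eq_zero_iff_of_nonneg hV.discrepancy_nonneg
    ((bddMeasurable_discrepancy hr α hV.bddMeasurable).integrable _)

lemma isGreatest_liftedQValue (ν : ProbabilityMeasure S) :
    IsGreatest (range (M.liftedQValue α (M.liftedOptValue α) ν)) (M.liftedOptValue α ν) :=
  ⟨⟨φ₀, (hV.liftedQValue_eq_liftedOptValue_iff hr hα0 hα1 hφ₀ ν φ₀).2 (.of_forall hφ₀)⟩,
    forall_mem_range.2 (hV.liftedQValue_le hr hα0 hα1 hφ₀ ν)⟩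

theorem isOptimalRuleAt_iff (ν : ProbabilityMeasure S) (φ : M.DecisionRule) :
    M.IsOptimalRuleAt α ν φ ↔
      ∀ᵐ s ∂(ν : Measure S), φ.toKernel s (M.maximizers α V s) = 1 := by
  have hmax := hV.isGreatest_liftedQValue hr hα0 hα1 hφ₀ ν
  rw [← hV.liftedQValue_eq_liftedOptValue_iff hr hα0 hα1 hφ₀, IsOptimalRuleAt,
    ← forall_mem_range (p := (· ≤ M.liftedQValue α (M.liftedOptValue α) ν φ))]
  exact ⟨fun h => IsGreatest.unique ⟨mem_range_self φ, h⟩ hmax, fun h => h ▸ hmax.2⟩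

theorem forall_isOptimalRuleAt_iff (φ : M.DecisionRule) :
    (∀ ν, M.IsOptimalRuleAt α ν φ) ↔ ∀ s, φ.toKernel s (M.maximizers α V s) = 1 := by
  simp only [hV.isOptimalRuleAt_iff hr hα0 hα1 hφ₀]
  refine ⟨fun h s => ?_, fun h ν => .of_forall h⟩
  -- Avoids a.e. statements for the Dirac measure on `S`, whose singletons may not be measurable.
  have hdirac : φ.jointLaw (Measure.dirac s) = φ.pairLaw s :=
    Measure.dirac_bind φ.pairLaw.measurable s
  rw [← hV.pairLaw_ae_iff hr, ← hdirac, hV.jointLaw_ae_iff hr]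
  exact h ⟨Measure.dirac s, inferInstance⟩

end IsBellmanSolution

/-- The decision rule that always chooses the action of a selector. -/
noncomputable def IsSelector.rule {f : S → U} (hf : M.IsSelector f) : M.DecisionRule where
  toKernel := Kernel.deterministic f hf.1
  markov := inferInstance
  feasible s := by
    rw [Kernel.deterministic_apply, Measure.dirac_apply_of_mem (hf.2 s)]

lemma IsSelector.rule_apply_eq_one {f : S → U} (hf : M.IsSelector f) {s : S} {A : Set U}
    (h : f s ∈ A) : hf.rule.toKernel s A = 1 :=
  (congrArg (· A) (Kernel.deterministic_apply hf.1 s)).trans (Measure.dirac_apply_of_mem h)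

lemma IsOptimalSelector.maximizers_eq_of_unique [MeasurableSingletonClass S] {α : ℝ} {f : S → U}
    (hf : M.IsOptimalSelector α f) (huniq : ∀ f', M.IsOptimalSelector α f' → f' = f) (s : S) :
    M.maximizers α (M.optValue α) s = {f s} := by
  classical
  refine Subset.antisymm (fun u hu => ?_) (singleton_subset_iff.2 (hf.2 s))
  let g : S → U := piecewise {s} (fun _ => u) f
  have hmax s' : g s' ∈ M.maximizers α (M.optValue α) s' := by
    by_cases h : s' = s
    · simpa [g, h] using hu
    · simpa [g, h] using hf.2 s'
  have hmeas : Measurable g := measurable_const.piecewise (measurableSet_singleton s) hf.1.1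
  have hgf : g = f := huniq g ⟨⟨hmeas, fun s' => (hmax s').1⟩, hmax⟩
  simpa [g] using congrFun hgf s

section Existence

variable [TopologicalSpace S] [OpensMeasurableSpace S] [TopologicalSpace U]
  [TopologicalSpace.MetrizableSpace U] [SecondCountableTopology U] [BorelSpace U] {α : ℝ}

theorem isBellmanSolution_optValue (hα0 : 0 ≤ α) (hα1 : α < 1) (hr : BddMeasurable M.r)
    (h_usc : UpperSemicontinuous M.r) (h_Q : M.StronglyContinuous)
    (hp : IsProperMap (state (M := M))) : M.IsBellmanSolution α (M.optValue α) := by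
  obtain ⟨V, hV⟩ := exists_isBellmanSolution hα0 hα1 hr h_usc h_Q hp
  obtain ⟨f, hfm, hf⟩ := exists_measurable_maximizer (α := α) h_usc h_Q hp hV.bddMeasurable
  have hsel : M.IsSelector f := ⟨hfm, fun s => (hf s).1⟩
  rwa [hV.optValue_eq hr hα0 hα1 fun s => hsel.rule_apply_eq_one (hf s)]

theorem exists_isOptimalSelector (h_usc : UpperSemicontinuous M.r) (h_Q : M.StronglyContinuous)
    (hp : IsProperMap (state (M := M))) (hV : BddMeasurable (M.optValue α)) :
    ∃ f, M.IsOptimalSelector α f := by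
  obtain ⟨f, hfm, hf⟩ := exists_measurable_maximizer (α := α) h_usc h_Q hp hV
  exact ⟨f, ⟨hfm, fun s => (hf s).1⟩, hf⟩

end Existence

end MDP

theorem theorem5p2_general {S U : Type*}
    [TopologicalSpace S] [MeasurableSpace S] [OpensMeasurableSpace S] [MeasurableSingletonClass S]
    [TopologicalSpace U] [TopologicalSpace.MetrizableSpace U] [SecondCountableTopology U]
    [MeasurableSpace U] [BorelSpace U]
    (M : MDP S U) (α : ℝ) (hα0 : 0 ≤ α) (hα1 : α < 1)
    (h_usc : UpperSemicontinuous M.r) (h_above : BddAbove (range M.r))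
    (h_below : BddBelow (range M.r)) (h_Q : M.StronglyContinuous)
    (h_proper : IsProperMap (MDP.state (M := M))) :
    M.SolvesDCOE α (M.optValue α) ∧
    M.SolvesLiftedDCOE α (M.liftedOptValue α) ∧
    (∃ f, M.IsOptimalSelector α f) ∧
    (∀ f, M.IsOptimalSelector α f →
      ∃ φ : M.DecisionRule, (∀ s, φ.toKernel s {f s} = 1) ∧ ∀ ν, M.IsOptimalRuleAt α ν φ) ∧
    (∀ (ν : ProbabilityMeasure S) (φ : M.DecisionRule), M.IsOptimalRuleAt α ν φ ↔
      ∀ᵐ s ∂(ν : Measure S), φ.toKernel s (M.maximizers α (M.optValue α) s) = 1) ∧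
    (∀ φ : M.DecisionRule, (∀ ν, M.IsOptimalRuleAt α ν φ) ↔
      ∀ s, φ.toKernel s (M.maximizers α (M.optValue α) s) = 1) ∧
    (∀ f, M.IsOptimalSelector α f → (∀ f', M.IsOptimalSelector α f' → f' = f) →
      ∀ φ : M.DecisionRule, (∀ ν, M.IsOptimalRuleAt α ν φ) → ∀ s, φ.toKernel s {f s} = 1) := by
  have hr := BddMeasurable.of_bddAbove_of_bddBelow M.measurable_r h_above h_below
  have hV := MDP.isBellmanSolution_optValue hα0 hα1 hr h_usc h_Q h_proper
  obtain ⟨f, hf⟩ := MDP.exists_isOptimalSelector h_usc h_Q h_proper hV.bddMeasurable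
  have hφ₀ s : hf.1.rule.toKernel s (M.maximizers α (M.optValue α) s) = 1 :=
    hf.1.rule_apply_eq_one (hf.2 s)
  have hall := hV.forall_isOptimalRuleAt_iff hr hα0 hα1 hφ₀
  refine ⟨fun s => (hV.isGreatest s).isLUB,
    fun ν => (hV.isGreatest_liftedQValue hr hα0 hα1 hφ₀ ν).isLUB, ⟨f, hf⟩, fun g hg => ?_,
    hV.isOptimalRuleAt_iff hr hα0 hα1 hφ₀, hall, fun g hg huniq φ hφ s => ?_⟩
  · exact ⟨hg.1.rule, fun s => hg.1.rule_apply_eq_one rfl,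
      (hall _).2 fun s => hg.1.rule_apply_eq_one (hg.2 s)⟩
  · rw [← hg.maximizers_eq_of_unique huniq s]
    exact (hall φ).1 hφ s

theorem theorem5p2 {S U : Type*}
    [TopologicalSpace S] [TopologicalSpace.MetrizableSpace S] [SecondCountableTopology S]
    [MeasurableSpace S] [BorelSpace S] [StandardBorelSpace S]
    [TopologicalSpace U] [TopologicalSpace.MetrizableSpace U] [SecondCountableTopology U]
    [MeasurableSpace U] [BorelSpace U] [StandardBorelSpace U]
    (M : MDP S U) (α : ℝ) (hα0 : 0 ≤ α) (hα1 : α < 1)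
    -- the reward is upper semicontinuous, bounded above and sup-compact
    (h_usc : UpperSemicontinuous M.r)
    (h_above : BddAbove (Set.range M.r))
    (h_sup : M.SupCompact)
    -- the transition law is strongly continuous
    (h_Q : M.StronglyContinuous)
    -- some policy has a finite value from every initial state
    (h_fin : ∃ π : M.Policy, ∀ s, Integrable (M.totalReward α) (π.law (Measure.dirac s)))
    -- the reward is bounded below
    (h_below : BddBelow (Set.range M.r))
    -- the feasible pairs over a compact set of states form a compact set
    (h_cpt : ∀ C : Set S, IsCompact C →
      IsCompact {p : S × U | p.1 ∈ C ∧ p.2 ∈ M.feasible p.1}) :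
    -- the two value functions solve their optimality equations, and optimal selectors exist
    M.SolvesDCOE α (M.optValue α) ∧
    M.SolvesLiftedDCOE α (M.liftedOptValue α) ∧
    (∃ f, M.IsOptimalSelector α f) ∧
    -- the Dirac kernel at any optimal selector attains the maximum at every `ν`
    (∀ f, M.IsOptimalSelector α f →
      ∃ φ : M.DecisionRule, (∀ s, φ.toKernel s {f s} = 1) ∧ ∀ ν, M.IsOptimalRuleAt α ν φ) ∧
    -- optimality at `ν` means concentration on optimal actions, for `ν`-almost every state
    (∀ (ν : ProbabilityMeasure S) (φ : M.DecisionRule), M.IsOptimalRuleAt α ν φ ↔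
      ∀ᵐ s ∂(ν : Measure S), φ.toKernel s (M.maximizers α (M.optValue α) s) = 1) ∧
    -- optimality at every `ν` means concentration on optimal actions, for every state
    (∀ φ : M.DecisionRule, (∀ ν, M.IsOptimalRuleAt α ν φ) ↔
      ∀ s, φ.toKernel s (M.maximizers α (M.optValue α) s) = 1) ∧
    -- if the optimal selector is unique, the rule optimal at every `ν` is its Dirac kernel
    (∀ f, M.IsOptimalSelector α f → (∀ f', M.IsOptimalSelector α f' → f' = f) →
      ∀ φ : M.DecisionRule, (∀ ν, M.IsOptimalRuleAt α ν φ) → ∀ s, φ.toKernel s {f s} = 1) :=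
  theorem5p2_general M α hα0 hα1 h_usc h_above h_below h_Q (MDP.isProperMap_state h_cpt)
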